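/- **Conventions.** A pushdown automaton (PDA) is $P=(Q,\Sigma,\Gamma,\delta,q_0,Z_0,F)$ with finite $Q,\Sigma,\Gamma$, $\delta: Q\times(\Sigma\cup\{\varepsilon\})\times\Gamma\to 2^{Q\times\Gamma^{\le 2}}$, $q_0\in Q$, $Z_0\in\Gamma$ and $F\subseteq Q$. A configuration is an element of $Q\times\Gamma^*$; a transition replaces the top stack symbol by a word of length at most two, and there is no transition from an empty stack. $L(P)$ is the set of words $w$ for which some run from $(q_0,Z_0)$ that reads $w$ (with $\varepsilon$-transitions allowed anywhere) ends in a state of $F$. For $k\in\mathbb N$, in the $k$-explorability game on $P$ each of $k$ tokens starts in $(q_0,Z_0)$. In each round Spoiler chooses a letter $a\in\Sigma$, and then Determiner moves each token along a path that consists of finitely many (possibly zero) $\varepsilon$-transitions followed by one transition reading $a$; she must be able to move every token. Determiner wins if, for every finite word $w$ (including the empty word) that is played by Spoiler in the rounds so far and lies in $L(P)$, at least one token is in a state of $F$ right after $w$ has been played. $P$ is $k$-explorable if Determiner has a winning strategy. For a finite alphabet $\Sigma$, $\mathsf{Expl}_k\text{-}\mathsf{CFL}$ is the class of languages $L\subseteq\Sigma^*$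 recognised by $k$-explorable PDAs, and $\mathsf{CFL}$ is the class of context-free languages $L\subseteq\Sigma^*$. **Theorem.** Let $\Sigma$ be a finite alphabet and $k\in\mathbb N=\{0,1,2,\dots\}$. Then $$\mathsf{Expl}_k\text{-}\mathsf{CFL}\subseteq\mathsf{Expl}_{k+1}\text{-}\mathsf{CFL}\subseteq\mathsf{CFL}.$$ If $\Sigma$ has at least two letters, both inclusions are strict: $$\mathsf{Expl}_k\text{-}\mathsf{CFL}\subsetneq\mathsf{Expl}_{k+1}\text{-}\mathsf{CFL}\subsetneq\mathsf{CFL}.$$ Moreover, for any two distinct letters $a,b\in\Sigma$, the language $L=\bigcup_{i=1}^{k+1}\{a^n b^{in}\mid n\in\mathbb N\}$ witnesses the first strict inclusion: $L$ is recognised by a $(k+1)$-explorable PDA, but by no $k$-explorable PDA. -/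

import Mathlib

namespace Explorability

/-- A pushdown automaton with states `Q`, input alphabet `α` and stack alphabet `Γ`.
`δ q (some a) Z` lists the moves that read the letter `a` in the mode `(q, Z)`, and `δ q none Z`
lists the `ε`-moves. A move `(p, β)` goes to state `p` and replaces the top symbol `Z` by the
word `β` of length at most two, whose first symbol becomes the new top. -/
structure PDA (Q α Γ : Type*) where
  δ : Q → Option α → Γ → Set (Q × List Γ)
  push_le_two : ∀ q x Z, ∀ m ∈ δ q x Z, m.2.length ≤ 2
  start : Q
  bottom : Γ
  accept : Set Q

namespace PDA

variable {Q α Γ : Type*} (P : PDA Q α Γ)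

/-- The initial configuration `(q₀, Z₀)`. A configuration is a state together with a stack,
written from the top downwards. -/
def init : Q × List Γ := (P.start, [P.bottom])

/-- One transition, labelled by a letter or by `ε` (`none`).
There is no transition from an empty stack. -/
inductive Step : Option α → Q × List Γ → Q × List Γ → Prop
  | mk (q p : Q) (x : Option α) (Z : Γ) (β γ : List Γ) (h : (p, β) ∈ P.δ q x Z) :
      Step x (q, Z :: γ) (p, β ++ γ)

/-- `P.Run c w d`: there is a run of `P` from `c` to `d` that reads exactly the word `w`
(with `ε`-transitions allowed anywhere, also at the end). -/
inductive Run : Q × List Γ → List α → Q × List Γ → Prop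
  | refl (c : Q × List Γ) : Run c [] c
  | eps {c c' d : Q × List Γ} {w : List α} (h : P.Step none c c') (r : Run c' w d) : Run c w d
  | read {c c' d : Q × List Γ} {a : α} {w : List α} (h : P.Step (some a) c c') (r : Run c' w d) :
      Run c (a :: w) d

/-- The language of `P`, by acceptance in a final state. -/
def language : Language α := {w | ∃ d : Q × List Γ, P.Run P.init w d ∧ d.1 ∈ P.accept}

/-- A legal move of one token when Spoiler plays `a`: finitely many (possibly zero)
`ε`-transitions, followed by one transition that reads `a`. -/
def TokenMove (a : α) (c d : Q × List Γ) : Prop :=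
  ∃ c' : Q × List Γ, Relation.ReflTransGen (P.Step none) c c' ∧ P.Step (some a) c' d

/-- `σ` is a winning strategy for Determiner in the `k`-explorability game on `P`.
Once her strategy is fixed, the history of a play is determined by the letters that Spoiler has
chosen, so a strategy gives, for each finite word played by Spoiler, the positions of the `k` tokens
after that word. All tokens start in the initial configuration, in every round each
of them makes a legal move, and whenever the word played so far is in the language of `P`, some
token is in an accepting state. -/
structure IsWinningStrategy (k : ℕ) (σ : List α → Fin k → Q × List Γ) : Prop where
  init : ∀ l, σ [] l = P.init
  move : ∀ w a l, P.TokenMove a (σ w l) (σ (w ++ [a]) l)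
  wins : ∀ w ∈ P.language, ∃ l, (σ w l).1 ∈ P.accept

/-- `P` is `k`-explorable: Determiner has a winning strategy in the `k`-explorability game. -/
def IsExplorable (k : ℕ) : Prop := ∃ σ : List α → Fin k → Q × List Γ, P.IsWinningStrategy k σ

end PDA

/-- The class of languages over `α` recognised by `k`-explorable pushdown automata
(with finitely many states and stack symbols). -/
def ExplCFL (k : ℕ) (α : Type*) : Set (Language α) :=
  {L | ∃ (Q Γ : Type) (_ : Finite Q) (_ : Finite Γ) (P : PDA Q α Γ),
    P.IsExplorable k ∧ P.language = L}

/-- The class of context-free languages over `α`. -/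
def CFL (α : Type*) : Set (Language α) := {L | L.IsContextFree}

/-- The language `⋃_{i=1}^{m} {aⁿ b^{i n} | n ∈ ℕ}`. -/
def multiplesLanguage {α : Type*} (a b : α) (m : ℕ) : Language α :=
  {w | ∃ i ∈ Finset.Icc 1 m, ∃ n : ℕ, w = List.replicate n a ++ List.replicate (i * n) b}

end Explorability

/-!
Runs of a pushdown automaton compose, and the triple construction turns the automaton into a grammar
with the same language, so explorable languages are context-free. An additional token costs nothing:
when there is already one, the new token copies it, and when there is none, the language is empty.
Running `k + 1` deterministic automata in parallel, one per token, recognises the union of their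
languages, and `{aⁿ b^{i n} | n ∈ ℕ}` is deterministic for each `i`.

For the lower bound, `k` tokens must serve the `k + 1` words `aⁿ b^{i n}` with `1 ≤ i ≤ k + 1`,
which are prefixes of one another. By the pigeonhole principle a single run accepts twice: after
`aⁿ b^{i n}` and, continuing, after `aⁿ b^{j n}` with `i < j`. Marking the letters read after the
first acceptance gives a context-free language. In each of its words that contains an unmarked `a`,
the number of unmarked `a`s divides both the length and the number of marked letters. For large `n`,
pumping breaks this: a window without an unmarked `a` changes the length by fewer than `n` letters,
and a window with an unmarked `a` ends before the marked part, so that pumping it gives more `a`s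
than marked letters.
-/

namespace Explorability

section ContextFree

variable {α N : Type*}

/-- The language of a sentential form in which each nonterminal `A` stands for the language `S A`.
A grammar generates the least `S` with `formLanguage S r.output ≤ S r.input` for all rules `r`. -/
def formLanguage (S : N → Language α) (s : List (Symbol α N)) : Language α :=
  (s.map fun
    | .terminal a => {[a]}
    | .nonterminal A => S A).prod

variable {S : N → Language α} {s t : List (Symbol α N)} {w : List α}

lemma mem_formLanguage_nil : w ∈ formLanguage S [] ↔ w = [] :=
  Language.mem_one w

lemma mem_formLanguage_cons_terminal {a : α} :
    w ∈ formLanguage S (.terminal a :: s) ↔ ∃ v ∈ formLanguage S s, a :: v = w := by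
  rw [formLanguage, List.map_cons, List.prod_cons, Language.mem_mul]
  exact ⟨fun ⟨_, rfl, v, hv, hw⟩ => ⟨v, hv, hw⟩, fun ⟨v, hv, hw⟩ => ⟨[a], rfl, v, hv, hw⟩⟩

lemma mem_formLanguage_cons_nonterminal {A : N} :
    w ∈ formLanguage S (.nonterminal A :: s) ↔ ∃ u ∈ S A, ∃ v ∈ formLanguage S s, u ++ v = w := by
  simp [formLanguage, Language.mem_mul]

lemma formLanguage_append : formLanguage S (s ++ t) = formLanguage S s * formLanguage S t := by
  simp [formLanguage]

lemma formLanguage_mono {S S' : N → Language α} (h : ∀ A, S A ≤ S' A) (s : List (Symbol α N)) :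
    formLanguage S s ≤ formLanguage S' s := by
  induction s with
  | nil => exact le_rfl
  | cons X s ih => cases X with
    | terminal a => exact mul_le_mul' le_rfl ih
    | nonterminal A => exact mul_le_mul' (h A) ih

lemma formLanguage_singleton_nonterminal (A : N) : formLanguage S [.nonterminal A] = S A := by
  simp [formLanguage]

lemma mem_formLanguage_map_terminal {v : List α} :
    w ∈ formLanguage S (v.map .terminal) ↔ w = v := by
  induction v generalizing w with
  | nil => exact mem_formLanguage_nil
  | cons a v ih => simp [mem_formLanguage_cons_terminal, ih, eq_comm]

end ContextFree

section Grammar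

variable {α : Type*} {g : ContextFreeGrammar α}

lemma formLanguage_le_of_derives {S : g.NT → Language α}
    (hS : ∀ r ∈ g.rules, formLanguage S r.output ≤ S r.input) {s t : List (Symbol α g.NT)}
    (h : g.Derives s t) : formLanguage S t ≤ formLanguage S s := by
  induction h with
  | refl => exact le_rfl
  | tail _ h ih =>
    refine le_trans ?_ ih
    obtain ⟨r, hr, hrw⟩ := h
    obtain ⟨p, q, rfl, rfl⟩ := hrw.exists_parts
    simp only [formLanguage_append, formLanguage_singleton_nonterminal]
    gcongr
    exact hS r hr

theorem mem_formLanguage_of_derives {S : g.NT → Language α}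
    (hS : ∀ r ∈ g.rules, formLanguage S r.output ≤ S r.input) {s : List (Symbol α g.NT)}
    {w : List α} (h : g.Derives s (w.map .terminal)) : w ∈ formLanguage S s :=
  formLanguage_le_of_derives hS h (mem_formLanguage_map_terminal.2 rfl)

lemma derives_output {r : ContextFreeRule α g.NT} (hr : r ∈ g.rules) :
    g.Derives [.nonterminal r.input] r.output :=
  .single ⟨r, hr, .input_output⟩

lemma derives_append {s s' t t' : List (Symbol α g.NT)} (hs : g.Derives s s')
    (ht : g.Derives t t') : g.Derives (s ++ t) (s' ++ t') :=
  (hs.append_right t).trans (ht.append_left s')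

/-- The language generated by `g` from the nonterminal `A`. -/
def languageFrom (g : ContextFreeGrammar α) (A : g.NT) : Language α :=
  {w | g.Derives [.nonterminal A] (w.map .terminal)}

lemma derives_of_mem_formLanguage {s : List (Symbol α g.NT)} {w : List α}
    (h : w ∈ formLanguage (languageFrom g) s) : g.Derives s (w.map .terminal) := by
  induction s generalizing w with
  | nil => rw [mem_formLanguage_nil.1 h]; exact .refl _
  | cons X s ih =>
    cases X with
    | terminal a =>
      obtain ⟨v, hv, rfl⟩ := mem_formLanguage_cons_terminal.1 h
      exact (ih hv).append_left [.terminal a]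
    | nonterminal A =>
      obtain ⟨u, hu, v, hv, rfl⟩ := mem_formLanguage_cons_nonterminal.1 h
      rw [List.map_append]
      exact derives_append hu (ih hv)

lemma formLanguage_output_le_languageFrom {r : ContextFreeRule α g.NT} (hr : r ∈ g.rules) :
    formLanguage (languageFrom g) r.output ≤ languageFrom g r.input :=
  fun _ h => (derives_output hr).trans (derives_of_mem_formLanguage h)

/-- `DerivesFactor g s w A x`: a derivation `s ⇒* w` has a subtree with root `A` and yield `x`, that
is, `s ⇒* u A z` and `A ⇒* x` with `w = u x z`. -/
def DerivesFactor (g : ContextFreeGrammar α) (s : List (Symbol α g.NT)) (w : List α) (A : g.NT)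
    (x : List α) : Prop :=
  ∃ u z : List α, w = u ++ x ++ z ∧
    g.Derives s (u.map .terminal ++ [.nonterminal A] ++ z.map .terminal) ∧ x ∈ languageFrom g A

namespace DerivesFactor

variable {s t : List (Symbol α g.NT)} {w v x : List α} {A B : g.NT}

lemma refl (h : w ∈ languageFrom g A) : DerivesFactor g [.nonterminal A] w A w :=
  ⟨[], [], by simp, .refl _, h⟩

lemma mem_languageFrom (h : DerivesFactor g s w A x) : x ∈ languageFrom g A :=
  h.choose_spec.choose_spec.2.2

lemma trans (h : DerivesFactor g s w A v) (h' : DerivesFactor g [.nonterminal A] v B x) :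
    DerivesFactor g s w B x := by
  obtain ⟨u, z, rfl, hs, -⟩ := h
  obtain ⟨u', z', rfl, hA, hx⟩ := h'
  refine ⟨u ++ u', z' ++ z, by simp, ?_, hx⟩
  simpa using hs.trans ((hA.append_left _).append_right _)

lemma of_derives (hst : g.Derives s t) (h : DerivesFactor g t w A x) :
    DerivesFactor g s w A x := by
  obtain ⟨u, z, hw, ht, hx⟩ := h
  exact ⟨u, z, hw, hst.trans ht, hx⟩

lemma append_left (hv : g.Derives s (v.map .terminal)) (h : DerivesFactor g t w A x) :
    DerivesFactor g (s ++ t) (v ++ w) A x := by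
  obtain ⟨u, z, rfl, ht, hx⟩ := h
  exact ⟨v ++ u, z, by simp, by simpa using derives_append hv ht, hx⟩

lemma append_right (h : DerivesFactor g s w A x) (hv : g.Derives t (v.map .terminal)) :
    DerivesFactor g (s ++ t) (w ++ v) A x := by
  obtain ⟨u, z, rfl, hs, hx⟩ := h
  exact ⟨u, z ++ v, by simp, by simpa using derives_append hs hv, hx⟩

end DerivesFactor

lemma exists_derivesFactor_of_mem_formLanguage {S : g.NT → Language α}
    (hS : ∀ A, S A ≤ languageFrom g A) {m : ℕ} (hm : 0 < m) {p : g.NT → List α → Prop}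
    (hp : ∀ A, ∀ w ∈ S A, m < w.length → ∃ B x, DerivesFactor g [.nonterminal A] w B x ∧ p B x)
    {s : List (Symbol α g.NT)} {w : List α} (hw : w ∈ formLanguage S s)
    (hlen : m * s.length < w.length) : ∃ B x, DerivesFactor g s w B x ∧ p B x := by
  induction s generalizing w with
  | nil => simp [mem_formLanguage_nil.1 hw] at hlen
  | cons X s ih =>
    rw [List.length_cons, Nat.mul_succ] at hlen
    cases X with
    | terminal a =>
      obtain ⟨v, hv, rfl⟩ := mem_formLanguage_cons_terminal.1 hw
      rw [List.length_cons] at hlen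
      obtain ⟨B, x, hx, hpx⟩ := ih hv (by lia)
      exact ⟨B, x, hx.append_left (s := [.terminal a]) (v := [a]) (.refl _), hpx⟩
    | nonterminal A =>
      obtain ⟨u, hu, v, hv, rfl⟩ := mem_formLanguage_cons_nonterminal.1 hw
      rw [List.length_append] at hlen
      by_cases hlen_v : m * s.length < v.length
      · obtain ⟨B, x, hx, hpx⟩ := ih hv hlen_v
        exact ⟨B, x, hx.append_left (s := [.nonterminal A]) (hS A hu), hpx⟩
      · obtain ⟨B, x, hx, hpx⟩ := hp A u hu (by lia)
        exact ⟨B, x, hx.append_right (derives_of_mem_formLanguage (formLanguage_mono hS s hv)), hpx⟩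

lemma exists_derivesFactor {b m : ℕ} (hb : ∀ r ∈ g.rules, r.output.length ≤ b) (hm : 0 < m)
    {A : g.NT} {w : List α} (hw : w ∈ languageFrom g A) (hlen : m < w.length) :
    ∃ B x, DerivesFactor g [.nonterminal A] w B x ∧
      B ∈ ContextFreeRule.input '' (g.rules : Set (ContextFreeRule α g.NT)) ∧
      m < x.length ∧ x.length ≤ b * m := by
  let S (A : g.NT) : Language α := {w | w ∈ languageFrom g A ∧ (m < w.length →
    ∃ B x, DerivesFactor g [.nonterminal A] w B x ∧
      B ∈ ContextFreeRule.input '' (g.rules : Set (ContextFreeRule α g.NT)) ∧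
      m < x.length ∧ x.length ≤ b * m)}
  have hS_le (A : g.NT) : S A ≤ languageFrom g A := fun _ h => h.1
  have hS : ∀ r ∈ g.rules, formLanguage S r.output ≤ S r.input := by
    intro r hr v hv
    have hv_lang : v ∈ languageFrom g r.input :=
      formLanguage_output_le_languageFrom hr (formLanguage_mono hS_le _ hv)
    refine ⟨hv_lang, fun hmv => ?_⟩
    by_cases hv_le : v.length ≤ b * m
    · exact ⟨r.input, v, .refl hv_lang, ⟨r, hr, rfl⟩, hmv, hv_le⟩
    · have hlen : m * r.output.length < v.length := by nlinarith [hb r hr]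
      obtain ⟨B, x, hx, hpx⟩ :=
        exists_derivesFactor_of_mem_formLanguage hS_le hm (fun _ _ h => h.2) hv hlen
      exact ⟨B, x, hx.of_derives (derives_output hr), hpx⟩
  have hwS := mem_formLanguage_of_derives hS hw
  rw [formLanguage_singleton_nonterminal] at hwS
  exact hwS.2 hlen

lemma exists_derivesFactor_chain {b : ℕ} (hb : ∀ r ∈ g.rules, r.output.length ≤ b) (hb_pos : 0 < b)
    (n : ℕ) {A : g.NT} {w : List α} (hw : w ∈ languageFrom g A) (hlen : b ^ n < w.length) :
    ∃ l : List (g.NT × List α), l.length = n ∧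
      (∀ p ∈ l, p.1 ∈ ContextFreeRule.input '' (g.rules : Set (ContextFreeRule α g.NT)) ∧
        DerivesFactor g [.nonterminal A] w p.1 p.2 ∧ p.2.length ≤ b ^ n) ∧
      l.Pairwise fun p q =>
        DerivesFactor g [.nonterminal p.1] p.2 q.1 q.2 ∧ q.2.length < p.2.length := by
  induction n generalizing A w with
  | zero => exact ⟨[], rfl, by simp, .nil⟩
  | succ n ih =>
    have hpos : 0 < b ^ n := pow_pos hb_pos n
    obtain ⟨B, x, hx, hB, hx_gt, hx_le⟩ :=
      exists_derivesFactor hb hpos hw (by rw [pow_succ] at hlen; nlinarith)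
    rw [← pow_succ'] at hx_le
    obtain ⟨l, rfl, hl, hl_pairwise⟩ := ih hx.mem_languageFrom hx_gt
    refine ⟨(B, x) :: l, rfl, ?_, List.pairwise_cons.2 ⟨fun q hq => ?_, hl_pairwise⟩⟩
    · rintro p (_ | ⟨_, hp⟩)
      · exact ⟨hB, hx, hx_le⟩
      · obtain ⟨hp_head, hp_factor, hp_len⟩ := hl p hp
        exact ⟨hp_head, hx.trans hp_factor, by lia⟩
    · obtain ⟨-, hq_factor, hq_len⟩ := hl q hq
      exact ⟨hq_factor, by lia⟩

lemma exists_derivesFactor_repeat {b : ℕ} (hb : ∀ r ∈ g.rules, r.output.length ≤ b)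
    (hb_pos : 0 < b) {A : g.NT} {w : List α} (hw : w ∈ languageFrom g A)
    (hlen : b ^ (g.rules.card + 1) < w.length) :
    ∃ B x x', DerivesFactor g [.nonterminal A] w B x ∧ x.length ≤ b ^ (g.rules.card + 1) ∧
      DerivesFactor g [.nonterminal B] x B x' ∧ x'.length < x.length := by
  classical
  obtain ⟨l, hl_len, hl, hl_pairwise⟩ := exists_derivesFactor_chain hb hb_pos _ hw hlen
  by_contra! hno
  have hnodup : (l.map Prod.fst).Nodup := by
    refine List.pairwise_map.2 (hl_pairwise.imp_of_mem ?_)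
    rintro ⟨B, x⟩ ⟨C, x'⟩ hp - ⟨hfactor, hlt⟩ rfl
    exact (hno B x x' (hl _ hp).2.1 (hl _ hp).2.2 hfactor).not_gt hlt
  have hsub : (l.map Prod.fst).toFinset ⊆ g.rules.image ContextFreeRule.input := by
    intro B hB
    obtain ⟨p, hp, rfl⟩ := List.mem_map.1 (List.mem_toFinset.1 hB)
    simpa using (hl p hp).1
  have hcard := (Finset.card_le_card hsub).trans Finset.card_image_le
  rw [List.toFinset_card_of_nodup hnodup, List.length_map, hl_len] at hcard
  lia

lemma derives_replicate_flatten {A : g.NT} {v y : List α}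
    (h : g.Derives [.nonterminal A] (v.map .terminal ++ [.nonterminal A] ++ y.map .terminal))
    (t : ℕ) :
    g.Derives [.nonterminal A] ((List.replicate t v).flatten.map .terminal ++ [.nonterminal A] ++
      (List.replicate t y).flatten.map .terminal) := by
  induction t with
  | zero => exact .refl _
  | succ t ih =>
    rw [List.replicate_succ', List.replicate_succ]
    simpa using ih.trans ((h.append_left _).append_right _)

theorem exists_pumping_of_isContextFree {L : Language α} (hL : L.IsContextFree) :
    ∃ p, ∀ w ∈ L, p ≤ w.length → ∃ u v x y z, w = u ++ v ++ x ++ y ++ z ∧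
      0 < (v ++ y).length ∧ (v ++ x ++ y).length ≤ p ∧
      ∀ t, u ++ (List.replicate t v).flatten ++ x ++ (List.replicate t y).flatten ++ z ∈ L := by
  obtain ⟨g, rfl⟩ := hL
  set b := g.rules.sup (·.output.length) + 1
  have hb : ∀ r ∈ g.rules, r.output.length ≤ b := fun r hr =>
    (Finset.le_sup (f := fun r : ContextFreeRule α g.NT => r.output.length) hr).trans
      (Nat.le_succ _)
  refine ⟨b ^ (g.rules.card + 1) + 1, fun w hw hlen => ?_⟩
  obtain ⟨B, -, x, ⟨u, z, rfl, hu, -⟩, hx_len, ⟨v, y, rfl, hv, hx⟩, hlt⟩ :=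
    exists_derivesFactor_repeat hb (Nat.succ_pos _) hw hlen
  refine ⟨u, v, x, y, z, by simp, ?_, by lia, fun t => ?_⟩
  · simp only [List.length_append] at hlt ⊢
    lia
  · have hpump := (derives_replicate_flatten hv t).trans ((hx.append_left _).append_right _)
    simpa using hu.trans ((hpump.append_left _).append_right _)

end Grammar

namespace PDA

section Runs

variable {Q α Γ Q' β Γ' : Type*} {P : PDA Q α Γ} {P' : PDA Q' β Γ'}

lemma Step.run {x : Option α} {c d e : Q × List Γ} {w : List α} (h : P.Step x c d)
    (r : P.Run d w e) : P.Run c (x.toList ++ w) e :=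
  match x with
  | none => .eps h r
  | some _ => .read h r

@[elab_as_elim]
theorem Run.step_induction {d : Q × List Γ} {motive : ∀ c w, P.Run c w d → Prop}
    (refl : motive d [] (.refl d))
    (step : ∀ x c c' w (h : P.Step x c c') (r : P.Run c' w d), motive c' w r →
      motive c (x.toList ++ w) (h.run r))
    {c : Q × List Γ} {w : List α} (r : P.Run c w d) : motive c w r := by
  induction r with
  | refl => exact refl
  | eps h r ih => exact step none _ _ _ h r (ih refl step)
  | read h r ih => exact step (some _) _ _ _ h r (ih refl step)

lemma Run.trans {c d e : Q × List Γ} {v w : List α} (r : P.Run c v d) (s : P.Run d w e) :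
    P.Run c (v ++ w) e := by
  induction r using Run.step_induction with
  | refl => exact s
  | step x c c' w h _ ih => rw [List.append_assoc]; exact h.run ih

lemma TokenMove.run {a : α} {c d : Q × List Γ} (h : P.TokenMove a c d) : P.Run c [a] d := by
  obtain ⟨c', hε, hread⟩ := h
  induction hε using Relation.ReflTransGen.head_induction_on with
  | refl => exact .read hread (.refl _)
  | head h _ ih => exact .eps h ih

lemma Run.map {f : Q × List Γ → Q' × List Γ'} {g : α → β}
    (hstep : ∀ x c d, P.Step x c d → P'.Step (x.map g) (f c) (f d)) {c d : Q × List Γ}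
    {w : List α} (r : P.Run c w d) : P'.Run (f c) (w.map g) (f d) := by
  induction r using Run.step_induction with
  | refl => exact .refl _
  | step x c c' w h _ ih => simpa [Option.toList_map] using (hstep x c c' h).run ih

lemma Run.exists_of_map {f : Q × List Γ → Q' × List Γ'} {g : α → β}
    (hstep : ∀ x c d', P'.Step x (f c) d' → ∃ y d, P.Step y c d ∧ x = y.map g ∧ d' = f d)
    {c : Q × List Γ} {d' : Q' × List Γ'} {w' : List β} (r : P'.Run (f c) w' d') :
    ∃ w d, P.Run c w d ∧ w' = w.map g ∧ d' = f d := by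
  generalize hc : f c = c' at r
  induction r using Run.step_induction generalizing c with
  | refl => exact ⟨[], c, .refl c, rfl, hc.symm⟩
  | step x c₁ c₂ w' h _ ih =>
    obtain ⟨y, e, hy, rfl, rfl⟩ := hstep x c c₂ (hc ▸ h)
    obtain ⟨w, d, r, rfl, hd⟩ := ih rfl
    exact ⟨y.toList ++ w, d, hy.run r, by simp [Option.toList_map], hd⟩

end Runs

section TripleConstruction

variable {Q α Γ : Type*}

/-- The configurations in which a run that started with the stack `Z :: γ` may end, as prescribed by
a triple `(q, Z, r)`: for `r = some p` the symbol `Z` has been popped and the state is `p`, and for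
`r = none` the state is accepting. -/
def target (P : PDA Q α Γ) : Option Q → List Γ → Set (Q × List Γ)
  | some p, γ => {(p, γ)}
  | none, _ => {d | d.1 ∈ P.accept}

/-- The words that label a run described by a triple: from `(q, Z :: γ)` into `P.target r γ`,
whatever the rest `γ` of the stack is. -/
def tripleLanguage (P : PDA Q α Γ) (A : Q × Γ × Option Q) : Language α :=
  {w | ∀ γ, ∃ d ∈ P.target A.2.2 γ, P.Run (A.1, A.2.1 :: γ) w d}

/-- The sentential form of the label of a transition. -/
def labelForm {N : Type*} (x : Option α) : List (Symbol α N) := x.toList.map .terminal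

/-- The rules of the triple construction. -/
inductive TripleRule (P : PDA Q α Γ) : ContextFreeRule α (Q × Γ × Option Q) → Prop
  | accept {q Z} (h : q ∈ P.accept) : TripleRule P ⟨(q, Z, none), []⟩
  | emptied {q p Z} (h : p ∈ P.accept) :
      TripleRule P ⟨(q, Z, none), [.nonterminal (q, Z, some p)]⟩
  | pop {q p x Z} (h : (p, []) ∈ P.δ q x Z) : TripleRule P ⟨(q, Z, some p), labelForm x⟩
  | swap {q p x Y Z r} (h : (p, [Y]) ∈ P.δ q x Z) :
      TripleRule P ⟨(q, Z, r), labelForm x ++ [.nonterminal (p, Y, r)]⟩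
  | push {q p p' x X Y Z r} (h : (p, [X, Y]) ∈ P.δ q x Z) :
      TripleRule P ⟨(q, Z, r),
        labelForm x ++ [.nonterminal (p, X, some p'), .nonterminal (p', Y, r)]⟩
  | push_accept {q p x X Y Z} (h : (p, [X, Y]) ∈ P.δ q x Z) :
      TripleRule P ⟨(q, Z, none), labelForm x ++ [.nonterminal (p, X, none)]⟩

variable {P : PDA Q α Γ}

lemma mem_formLanguage_labelForm_append {N : Type*} {S : N → Language α} {x : Option α}
    {s : List (Symbol α N)} {w : List α} :
    w ∈ formLanguage S (labelForm x ++ s) ↔ ∃ v ∈ formLanguage S s, x.toList ++ v = w := by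
  cases x with
  | none => simp [labelForm]
  | some a => exact mem_formLanguage_cons_terminal

lemma TripleRule.formLanguage_tripleLanguage_le {r : ContextFreeRule α (Q × Γ × Option Q)}
    (hr : P.TripleRule r) : formLanguage P.tripleLanguage r.output ≤ P.tripleLanguage r.input := by
  intro w hw γ
  cases hr with
  | accept h =>
    obtain rfl := mem_formLanguage_nil.1 hw
    exact ⟨_, h, .refl _⟩
  | emptied h =>
    rw [formLanguage_singleton_nonterminal] at hw
    obtain ⟨_, rfl, r⟩ := hw γ
    exact ⟨_, h, r⟩
  | pop h =>
    obtain rfl := mem_formLanguage_map_terminal.1 hw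
    exact ⟨_, rfl, by simpa using (Step.mk _ _ _ _ _ γ h).run (.refl _)⟩
  | swap h =>
    obtain ⟨v, hv, rfl⟩ := mem_formLanguage_labelForm_append.1 hw
    rw [formLanguage_singleton_nonterminal] at hv
    obtain ⟨d, hd, r⟩ := hv γ
    exact ⟨d, hd, (Step.mk _ _ _ _ _ γ h).run r⟩
  | @push _ p p' x X Y _ _ h =>
    obtain ⟨v, hv, rfl⟩ := mem_formLanguage_labelForm_append.1 hw
    obtain ⟨v₁, hv₁, v₂, hv₂, rfl⟩ := mem_formLanguage_cons_nonterminal.1 hv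
    rw [formLanguage_singleton_nonterminal] at hv₂
    obtain ⟨_, rfl, r₁⟩ := hv₁ (Y :: γ)
    obtain ⟨d, hd, r₂⟩ := hv₂ γ
    exact ⟨d, hd, (Step.mk _ _ _ _ _ γ h).run (r₁.trans r₂)⟩
  | @push_accept _ _ _ _ Y _ h =>
    obtain ⟨v, hv, rfl⟩ := mem_formLanguage_labelForm_append.1 hw
    rw [formLanguage_singleton_nonterminal] at hv
    obtain ⟨d, hd, r⟩ := hv (Y :: γ)
    exact ⟨d, hd, (Step.mk _ _ _ _ _ γ h).run r⟩

lemma finite_setOf_tripleRule [Finite Q] [Finite Γ] [Finite α] : {r | P.TripleRule r}.Finite := by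
  have := Fintype.ofFinite α
  have := Fintype.ofFinite (Q × Γ × Option Q)
  have hfin := (Set.finite_univ (α := Q × Γ × Option Q)).prod
    (List.finite_length_le (Symbol α (Q × Γ × Option Q)) 3)
  refine (hfin.image fun p => ContextFreeRule.mk p.1 p.2).subset fun r hr =>
    ⟨(r.input, r.output), ⟨trivial, ?_⟩, rfl⟩
  have label_length (x : Option α) :
      (labelForm x : List (Symbol α (Q × Γ × Option Q))).length ≤ 1 := by
    cases x <;> simp [labelForm]
  cases hr with
  | accept | emptied => simp
  | pop => exact (label_length _).trans (by simp)
  | swap | push | push_accept =>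
    simp only [Set.mem_ofPred_eq, List.length_append, List.length_cons, List.length_nil]
    linarith [label_length ‹_›]

/-- `StackDerives S q γ w`: the language family `S` accounts for `w` as the label of a run from
`(q, γ)` to an accepting state, by splitting `w` at the moments when the symbols of `γ` are
popped. -/
inductive StackDerives (P : PDA Q α Γ) (S : Q × Γ × Option Q → Language α) :
    Q → List Γ → List α → Prop
  | nil {q} (h : q ∈ P.accept) : StackDerives P S q [] []
  | accept {q Z γ w} (h : w ∈ S (q, Z, none)) : StackDerives P S q (Z :: γ) w
  | pop {q p Z γ v w} (h : v ∈ S (q, Z, some p)) (h' : StackDerives P S p γ w) :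
      StackDerives P S q (Z :: γ) (v ++ w)

variable {S : Q × Γ × Option Q → Language α}

lemma StackDerives.step (hS : ∀ r, P.TripleRule r → formLanguage S r.output ≤ S r.input)
    {q p : Q} {x : Option α} {Z : Γ} {β γ : List Γ} {w : List α} (hm : (p, β) ∈ P.δ q x Z)
    (h : P.StackDerives S p (β ++ γ) w) : P.StackDerives S q (Z :: γ) (x.toList ++ w) := by
  have unary {Y} {r r' : Option Q} {v} (hr : P.TripleRule
      ⟨(q, Z, r), labelForm x ++ [.nonterminal (p, Y, r')]⟩) (hv : v ∈ S (p, Y, r')) :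
      x.toList ++ v ∈ S (q, Z, r) :=
    hS _ hr (mem_formLanguage_labelForm_append.2
      ⟨v, by rwa [formLanguage_singleton_nonterminal], rfl⟩)
  have binary {X Y p' r u v} (hr : P.TripleRule ⟨(q, Z, r),
      labelForm x ++ [.nonterminal (p, X, some p'), .nonterminal (p', Y, r)]⟩)
      (hu : u ∈ S (p, X, some p')) (hv : v ∈ S (p', Y, r)) :
      x.toList ++ (u ++ v) ∈ S (q, Z, r) :=
    hS _ hr (mem_formLanguage_labelForm_append.2 ⟨u ++ v, mem_formLanguage_cons_nonterminal.2
      ⟨u, hu, v, by rwa [formLanguage_singleton_nonterminal], rfl⟩, rfl⟩)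
  match β, P.push_le_two _ _ _ _ hm with
  | [], _ => exact .pop (hS _ (.pop hm) (mem_formLanguage_map_terminal.2 rfl)) h
  | [Y], _ =>
    cases h with
    | accept hw => exact .accept (unary (.swap hm) hw)
    | pop hv h => rw [← List.append_assoc]; exact .pop (unary (.swap hm) hv) h
  | [X, Y], _ =>
    cases h with
    | accept hw => exact .accept (unary (.push_accept hm) hw)
    | pop hu h => cases h with
      | accept hv => exact .accept (binary (.push hm) hu hv)
      | pop hv h =>
        rw [← List.append_assoc, ← List.append_assoc, List.append_assoc x.toList]
        exact .pop (binary (.push hm) hu hv) h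

lemma Run.stackDerives (hS : ∀ r, P.TripleRule r → formLanguage S r.output ≤ S r.input)
    {c d : Q × List Γ} {w : List α} (r : P.Run c w d) (hd : d.1 ∈ P.accept) :
    P.StackDerives S c.1 c.2 w := by
  induction r using Run.step_induction with
  | refl =>
    obtain ⟨q, _ | ⟨Z, γ⟩⟩ := d
    · exact .nil hd
    · exact .accept (hS _ (.accept hd) (mem_formLanguage_nil.2 rfl))
  | step x c c' w h _ ih => cases h with
    | mk q p x Z β γ hm => exact .step hS hm ih

lemma language_le_of_tripleRule
    (hS : ∀ r, P.TripleRule r → formLanguage S r.output ≤ S r.input) :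
    P.language ≤ S (P.start, P.bottom, none) := by
  rintro w ⟨d, r, hd⟩
  cases r.stackDerives hS hd with
  | accept h => exact h
  | pop h h' => cases h' with
    | nil hp =>
      refine hS _ (.emptied hp) ?_
      rwa [formLanguage_singleton_nonterminal, List.append_nil]

/-- The grammar of the triple construction for `P`. -/
noncomputable def tripleGrammar {Q Γ : Type} [Finite Q] [Finite Γ] [Finite α] (P : PDA Q α Γ) :
    ContextFreeGrammar α where
  NT := Q × Γ × Option Q
  initial := (P.start, P.bottom, none)
  rules := (finite_setOf_tripleRule (P := P)).toFinset

theorem language_tripleGrammar {Q Γ : Type} [Finite Q] [Finite Γ] [Finite α] (P : PDA Q α Γ) :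
    P.tripleGrammar.language = P.language := by
  have mem_rules {r} : r ∈ P.tripleGrammar.rules ↔ P.TripleRule r := Set.Finite.mem_toFinset _
  refine le_antisymm (fun w hw => ?_) (language_le_of_tripleRule
    (S := languageFrom P.tripleGrammar)
    fun r hr => formLanguage_output_le_languageFrom (mem_rules.2 hr))
  have hw' : w ∈ P.tripleLanguage (P.start, P.bottom, none) :=
    (formLanguage_singleton_nonterminal _).le (mem_formLanguage_of_derives
      (fun r hr => (mem_rules.1 hr).formLanguage_tripleLanguage_le) hw)
  obtain ⟨d, hd, r⟩ := hw' []
  exact ⟨d, r, hd⟩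

end TripleConstruction

end PDA

theorem isContextFree_of_mem_ExplCFL {α : Type*} [Finite α] {k : ℕ} {L : Language α}
    (hL : L ∈ ExplCFL k α) : L.IsContextFree := by
  obtain ⟨Q, Γ, _, _, P, -, rfl⟩ := hL
  exact ⟨P.tripleGrammar, P.language_tripleGrammar⟩

namespace PDA

section RealTime

variable {Q α Γ : Type*} {P : PDA Q α Γ} {move : Q → α → Γ → Q × List Γ}

/-- The effect of a move function on configurations; it leaves an empty stack empty. -/
def moveStep (move : Q → α → Γ → Q × List Γ) : Q × List Γ → α → Q × List Γ
  | (q, []), _ => (q, [])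
  | (q, Z :: γ), a => ((move q a Z).1, (move q a Z).2 ++ γ)

/-- `P` is a deterministic automaton without `ε`-moves, given by the function `move`, and it never
gets stuck on an empty stack. -/
structure IsRealTime (P : PDA Q α Γ) (move : Q → α → Γ → Q × List Γ) : Prop where
  mem_δ_iff : ∀ {q x Z m}, m ∈ P.δ q x Z ↔ ∃ a, x = some a ∧ m = move q a Z
  stack_ne_nil : ∀ w : List α, (w.foldl (moveStep move) P.init).2 ≠ []

namespace IsRealTime

variable (hP : P.IsRealTime move)
include hP

lemma eq_foldl_of_run {c d : Q × List Γ} {w : List α} (r : P.Run c w d) :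
    d = w.foldl (moveStep move) c := by
  induction r using Run.step_induction with
  | refl => rfl
  | step x c c' w h _ ih => cases h with
    | mk q p x Z β γ hm =>
      obtain ⟨a, rfl, hmove⟩ := hP.mem_δ_iff.1 hm
      simpa [moveStep, ← hmove] using ih

lemma step_foldl (w : List α) (a : α) :
    P.Step (some a) (w.foldl (moveStep move) P.init) ((w ++ [a]).foldl (moveStep move) P.init) := by
  have hne := hP.stack_ne_nil w
  rw [List.foldl_append]
  generalize w.foldl (moveStep move) P.init = c at hne
  obtain ⟨q, _ | ⟨Z, γ⟩⟩ := c
  · exact absurd rfl hne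
  · exact .mk _ _ _ _ _ _ (hP.mem_δ_iff.2 ⟨a, rfl, rfl⟩)

lemma run_foldl (w : List α) : P.Run P.init w (w.foldl (moveStep move) P.init) := by
  induction w using List.reverseRecOn with
  | nil => exact .refl _
  | append_singleton w a ih => exact ih.trans (.read (hP.step_foldl w a) (.refl _))

lemma mem_language_iff {w : List α} :
    w ∈ P.language ↔ (w.foldl (moveStep move) P.init).1 ∈ P.accept :=
  ⟨fun ⟨_, r, hd⟩ => hP.eq_foldl_of_run r ▸ hd, fun h => ⟨_, hP.run_foldl w, h⟩⟩

theorem isExplorable_one : P.IsExplorable 1 :=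
  ⟨fun w _ => w.foldl (moveStep move) P.init, fun _ => rfl,
    fun w a _ => ⟨_, .refl, hP.step_foldl w a⟩, fun _ hw => ⟨0, hP.mem_language_iff.1 hw⟩⟩

end IsRealTime

end RealTime

lemma IsExplorable.of_surjective {Q α Γ : Type*} {P : PDA Q α Γ} {j k : ℕ} (hP : P.IsExplorable k)
    {f : Fin j → Fin k} (hf : Function.Surjective f) : P.IsExplorable j := by
  obtain ⟨σ, hσ⟩ := hP
  refine ⟨fun w l => σ w (f l), fun l => hσ.init _, fun w a l => hσ.move w a _, fun w hw => ?_⟩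
  obtain ⟨l, hl⟩ := hσ.wins w hw
  obtain ⟨l, rfl⟩ := hf l
  exact ⟨l, hl⟩

/-- A deterministic real-time automaton that accepts nothing. -/
def rejecting (α : Type*) : PDA Unit α Unit where
  δ _ x _ := {m | ∃ a : α, x = some a ∧ m = ((), [()])}
  push_le_two := by rintro _ _ _ _ ⟨-, -, rfl⟩; simp
  start := ()
  bottom := ()
  accept := ∅

lemma rejecting_isRealTime (α : Type*) :
    (rejecting α).IsRealTime fun _ _ _ => ((), [()]) where
  mem_δ_iff := Iff.rfl
  stack_ne_nil w := by
    suffices h : w.foldl (moveStep fun _ _ _ => ((), [()])) (rejecting α).init =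
        (rejecting α).init by rw [h]; exact List.cons_ne_nil _ _
    exact List.foldl_fixed' (fun _ => rfl) w

section Union

variable {ι Q α Γ : Type*} {P : ι → PDA Q α Γ}

/-- The automaton that first chooses one of the automata `P i` by an `ε`-move and then runs it. Its
initial state is accepting as soon as that of some `P i` is, because on the empty word Determiner
cannot leave it. -/
def union (P : ι → PDA Q α Γ) (Z₀ : Γ) : PDA (Option (ι × Q)) α Γ where
  δ
    | none, x, _ => {m | x = none ∧ ∃ i, m = (some (i, (P i).start), [(P i).bottom])}
    | some (i, q), x, Z => {m | ∃ p β, (p, β) ∈ (P i).δ q x Z ∧ m = (some (i, p), β)}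
  push_le_two := by
    rintro (_ | ⟨i, q⟩) x Z m
    · rintro ⟨-, i, rfl⟩; simp
    · rintro ⟨p, β, hm, rfl⟩; exact (P i).push_le_two _ _ _ _ hm
  start := none
  bottom := Z₀
  accept
    | none => ∃ i, (P i).start ∈ (P i).accept
    | some (i, q) => q ∈ (P i).accept

/-- The configuration of `union P Z₀` that corresponds to a configuration of `P i`. -/
def unionConfig (i : ι) (c : Q × List Γ) : Option (ι × Q) × List Γ := (some (i, c.1), c.2)

variable {Z₀ : Γ} {i : ι}

lemma Step.toUnion {x : Option α} {c d : Q × List Γ} (h : (P i).Step x c d) :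
    (union P Z₀).Step x (unionConfig i c) (unionConfig i d) := by
  obtain ⟨q, p, x, Z, β, γ, hm⟩ := h
  exact .mk _ _ _ _ _ _ ⟨p, β, hm, rfl⟩

lemma Step.exists_of_unionConfig {x : Option α} {c : Q × List Γ} {d' : Option (ι × Q) × List Γ}
    (h : (union P Z₀).Step x (unionConfig i c) d') :
    ∃ d, (P i).Step x c d ∧ d' = unionConfig i d := by
  obtain ⟨q, _ | ⟨Z, γ⟩⟩ := c
  · cases h
  · cases h with
    | mk _ _ _ _ β' _ hm =>
      obtain ⟨p, β, hm, h⟩ := hm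
      obtain ⟨rfl, rfl⟩ := Prod.mk.inj h
      exact ⟨_, .mk q p x Z β' γ hm, rfl⟩

lemma union_step_init (i : ι) :
    (union P Z₀).Step none (union P Z₀).init (unionConfig i (P i).init) :=
  Step.mk (P := union P Z₀) none _ none Z₀ _ [] ⟨rfl, i, rfl⟩

lemma eq_of_union_step_init {x : Option α} {d : Option (ι × Q) × List Γ}
    (h : (union P Z₀).Step x (union P Z₀).init d) :
    x = none ∧ ∃ i, d = unionConfig i (P i).init := by
  cases h with
  | mk _ _ _ _ _ _ hm =>
    obtain ⟨rfl, i, h⟩ := hm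
    obtain ⟨rfl, rfl⟩ := Prod.mk.inj h
    exact ⟨rfl, i, rfl⟩

theorem mem_language_union_iff {w : List α} :
    w ∈ (union P Z₀).language ↔ ∃ i, w ∈ (P i).language := by
  constructor
  · rintro ⟨d', r, hd⟩
    cases r with
    | refl =>
      obtain ⟨i, hi⟩ := hd
      exact ⟨i, (P i).init, .refl _, hi⟩
    | eps h r =>
      obtain ⟨-, i, rfl⟩ := eq_of_union_step_init h
      obtain ⟨w, d, r, rfl, rfl⟩ := Run.exists_of_map (g := id)
        (fun x c d' (h : (union P Z₀).Step x (unionConfig i c) d') =>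
          have ⟨d, hd, h⟩ := h.exists_of_unionConfig
          ⟨x, d, hd, by simp, h⟩) r
      exact ⟨i, d, by rwa [List.map_id], hd⟩
    | read h _ => simpa using (eq_of_union_step_init h).1
  · rintro ⟨i, d, r, hd⟩
    refine ⟨unionConfig i d, .eps (union_step_init i) ?_, hd⟩
    simpa using r.map (g := id) (P' := union P Z₀) fun x c d h => by simpa using h.toUnion

lemma TokenMove.toUnion {a : α} {c d : Q × List Γ} (h : (P i).TokenMove a c d) :
    (union P Z₀).TokenMove a (unionConfig i c) (unionConfig i d) := by
  obtain ⟨c', hε, hread⟩ := h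
  exact ⟨_, hε.lift _ fun _ _ => Step.toUnion, hread.toUnion⟩

lemma TokenMove.of_step {P : PDA Q α Γ} {a : α} {c c' d : Q × List Γ} (h : P.Step none c c')
    (h' : P.TokenMove a c' d) : P.TokenMove a c d :=
  have ⟨e, hε, hread⟩ := h'
  ⟨e, .head h hε, hread⟩

theorem union_isExplorable {m k : ℕ} {P : Fin m → PDA Q α Γ} (hP : ∀ i, (P i).IsExplorable k) :
    (union P Z₀).IsExplorable (m * k) := by
  choose σ hσ using hP
  let token (w : List α) (i : Fin m) (j : Fin k) := unionConfig i (σ i w j)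
  have token_move (w a i j) : (union P Z₀).TokenMove a (token w i j) (token (w ++ [a]) i j) :=
    ((hσ i).move w a j).toUnion
  refine ⟨fun w l => if w = [] then (union P Z₀).init else
    token w (finProdFinEquiv.symm l).1 (finProdFinEquiv.symm l).2, fun _ => if_pos rfl,
    fun w a l => ?_, fun w hw => ?_⟩
  · rw [if_neg (List.append_ne_nil_of_right_ne_nil w (List.cons_ne_nil a []))]
    split_ifs with hw
    · subst hw
      refine .of_step (union_step_init (finProdFinEquiv.symm l).1) ?_
      simpa only [token, (hσ _).init] using token_move [] a _ _
    · exact token_move w a _ _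
  · obtain ⟨i, hi⟩ := mem_language_union_iff.1 hw
    obtain ⟨j, hj⟩ := (hσ i).wins w hi
    refine ⟨finProdFinEquiv (i, j), ?_⟩
    split_ifs with h
    · subst h
      rw [(hσ i).init] at hj
      exact ⟨i, hj⟩
    · rwa [Equiv.symm_apply_apply]

end Union

end PDA

section Monotone

variable {α : Type*}

lemma zero_mem_ExplCFL_one : (0 : Language α) ∈ ExplCFL 1 α :=
  ⟨Unit, Unit, inferInstance, inferInstance, PDA.rejecting α,
    (PDA.rejecting_isRealTime α).isExplorable_one, Set.eq_empty_of_forall_notMem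
      fun _ ⟨_, _, h⟩ => h⟩

theorem ExplCFL_subset_succ (k : ℕ) (α : Type*) : ExplCFL k α ⊆ ExplCFL (k + 1) α := by
  rintro L ⟨Q, Γ, hQ, hΓ, P, hP, rfl⟩
  cases k with
  | zero =>
    obtain ⟨σ, hσ⟩ := hP
    have : P.language = 0 :=
      Set.eq_empty_of_forall_notMem fun w hw => (hσ.wins w hw).choose.elim0
    exact this ▸ zero_mem_ExplCFL_one
  | succ k =>
    exact ⟨Q, Γ, hQ, hΓ, P, hP.of_surjective (Fin.predAbove_surjective 0), rfl⟩

end Monotone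

section Ratio

lemma exists_cons_eq_replicate_append {α : Type*} {a b x : α} {w : List α} {f : ℕ → ℕ} :
    (∃ m, x :: w = List.replicate m a ++ List.replicate (f m) b) ↔
      x :: w = List.replicate (f 0) b ∨
        x = a ∧ ∃ m, w = List.replicate m a ++ List.replicate (f (m + 1)) b := by
  rw [← Nat.or_exists_add_one]
  simp [List.replicate_succ]

/-- The control states of `ratioPDA`. In `push` the letters `a` are counted on the stack; in `pop c`
the top of the stack stands for `c + 1` letters `b` that are still to be read. -/
inductive RatioState (k : ℕ)
  | start | push | pop (c : Fin (k + 1)) | done | dead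
  deriving Fintype

open RatioState

variable {α : Type*} [DecidableEq α] {a b : α} {k : ℕ}

/-- The move of `ratioPDA` on the letter `b` when the top symbol stands for `c + 1` such letters. -/
def spendMove (i c : Fin (k + 1)) (Z : Bool) : RatioState k × List Bool :=
  if c ≠ 0 then (pop (c - 1), [Z]) else if Z then (done, [Z]) else (pop i, [])

/-- The move function of `ratioPDA`. -/
def ratioMove (a b : α) (i : Fin (k + 1)) : RatioState k → α → Bool → RatioState k × List Bool
  | start, x, Z => if x = a then (push, [Z]) else (dead, [Z])
  | push, x, Z =>
    if x = a then (push, [false, Z]) else if x = b then spendMove i i Z else (dead, [Z])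
  | pop c, x, Z => if x = b then spendMove i c Z else (dead, [Z])
  | done, _, Z | dead, _, Z => (dead, [Z])

/-- A deterministic automaton for `{aⁿ b^{(i + 1) n}}`. Its stack holds one symbol for each letter
`a`, the lowest of which is `true` and the others `false`. -/
def ratioPDA (a b : α) (i : Fin (k + 1)) : PDA (RatioState k) α Bool where
  δ q x Z := {m | ∃ y, x = some y ∧ m = ratioMove a b i q y Z}
  push_le_two := by
    rintro q x Z m ⟨y, -, rfl⟩
    cases q <;> simp only [ratioMove, spendMove] <;> (try split_ifs) <;> simp
  start := start
  bottom := true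
  accept := {start, done}

/-- One transition of `ratioPDA`. -/
abbrev ratioStep (a b : α) (i : Fin (k + 1)) :
    RatioState k × List Bool → α → RatioState k × List Bool :=
  PDA.moveStep (ratioMove a b i)

lemma true_mem_ratioMove (i : Fin (k + 1)) (q : RatioState k) (x : α) :
    true ∈ (ratioMove a b i q x true).2 := by
  cases q <;> simp only [ratioMove, spendMove] <;> (try split_ifs) <;> simp_all

lemma true_mem_foldl_ratioStep {i : Fin (k + 1)} {c : RatioState k × List Bool} (hc : true ∈ c.2)
    (w : List α) : true ∈ (w.foldl (ratioStep a b i) c).2 := by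
  induction w generalizing c with
  | nil => exact hc
  | cons x _ ih =>
    refine ih ?_
    obtain ⟨q, _ | ⟨Z, γ⟩⟩ := c
    · exact hc
    · rcases List.mem_cons.1 hc with rfl | hγ
      · exact List.mem_append_left _ (true_mem_ratioMove i q x)
      · exact List.mem_append_right _ hγ

lemma ratioPDA_isRealTime (a b : α) (i : Fin (k + 1)) :
    (ratioPDA a b i).IsRealTime (ratioMove a b i) where
  mem_δ_iff := Iff.rfl
  stack_ne_nil w := List.ne_nil_of_mem
    (true_mem_foldl_ratioStep (c := (ratioPDA a b i).init) (List.mem_singleton_self true) w)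

/-- The stack of `ratioPDA` after `n + 1` letters `a`. -/
def ratioStack (n : ℕ) : List Bool := List.replicate n false ++ [true]

lemma ratioStack_succ (n : ℕ) : ratioStack (n + 1) = false :: ratioStack n := rfl

/-- `w` leads `ratioPDA a b i` from `c` to acceptance. -/
def RatioAccepts (a b : α) (i : Fin (k + 1)) (c : RatioState k × List Bool) (w : List α) : Prop :=
  (w.foldl (ratioStep a b i) c).1 ∈ (ratioPDA a b i).accept

variable {i c : Fin (k + 1)} {n : ℕ} {w : List α}

lemma ratioAccepts_nil {q : RatioState k} {γ : List Bool} :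
    RatioAccepts a b i (q, γ) [] ↔ q = start ∨ q = done := by
  rfl

lemma ratioAccepts_cons {q : RatioState k} {Z : Bool} {γ : List Bool} {x : α} :
    RatioAccepts a b i (q, Z :: γ) (x :: w) ↔ RatioAccepts a b i
      ((ratioMove a b i q x Z).1, (ratioMove a b i q x Z).2 ++ γ) w := by
  rfl

lemma not_ratioAccepts_dead {γ : List Bool} : ¬ RatioAccepts a b i (dead, γ) w := by
  induction w generalizing γ with
  | nil => simp [ratioAccepts_nil]
  | cons x w ih => cases γ <;> exact ih

lemma ratioAccepts_done {Z : Bool} {γ : List Bool} :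
    RatioAccepts a b i (done, Z :: γ) w ↔ w = [] := by
  cases w with
  | nil => simp [ratioAccepts_nil]
  | cons x w => simp [ratioAccepts_cons, ratioMove, not_ratioAccepts_dead]

lemma ratioAccepts_pop :
    RatioAccepts a b i (pop c, ratioStack n) w ↔ w = List.replicate (n * (i + 1) + c + 1) b := by
  induction w generalizing n c with
  | nil => simp [ratioAccepts_nil, List.replicate_succ]
  | cons x w ih =>
    rw [List.replicate_succ, List.cons.injEq]
    by_cases hx : x = b
    · by_cases hc : c = 0
      · cases n with
        | zero => simp [ratioStack, ratioAccepts_cons, ratioMove, spendMove, hx, hc,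
            ratioAccepts_done]
        | succ n =>
          have hlen : (n + 1) * (i + 1 : ℕ) = n * (i + 1) + i + 1 := by ring
          simp [ratioStack_succ, ratioAccepts_cons, ratioMove, spendMove, hx, hc, ih, hlen]
      · have hlen : (c : ℕ) = (c - 1 : Fin (k + 1)) + 1 := by
          rw [Fin.val_sub_one_of_ne_zero hc]
          have := Fin.val_ne_zero_iff.2 hc
          lia
        rw [hlen, ← add_assoc, ← ih]
        cases n <;> simp [ratioStack, List.replicate_succ, ratioAccepts_cons, ratioMove, spendMove,
          hx, hc]
    · cases n <;> simp [ratioStack, List.replicate_succ, ratioAccepts_cons, ratioMove, hx,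
        not_ratioAccepts_dead]

lemma ratioAccepts_push (hab : a ≠ b) :
    RatioAccepts a b i (push, ratioStack n) w ↔
      ∃ m, w = List.replicate m a ++ List.replicate ((n + m + 1) * (i + 1)) b := by
  induction w generalizing n with
  | nil => simp [ratioAccepts_nil]
  | cons x w ih =>
    rw [exists_cons_eq_replicate_append]
    have hlen : (n + 0 + 1) * (i + 1 : ℕ) = n * (i + 1) + i + 1 := by ring
    rw [hlen]
    by_cases hx : x = a
    · have hmove : RatioAccepts a b i (push, ratioStack n) (x :: w) ↔
          RatioAccepts a b i (push, ratioStack (n + 1)) w := by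
        cases n <;> simp [ratioStack, List.replicate_succ, ratioAccepts_cons, ratioMove, hx]
      rw [hmove]
      simp [ih, List.replicate_succ, hx, hab, add_right_comm _ 1, ← add_assoc]
    · have hmove : RatioAccepts a b i (push, ratioStack n) (x :: w) ↔
          RatioAccepts a b i (pop i, ratioStack n) (x :: w) := by
        cases n <;> simp [ratioStack, List.replicate_succ, ratioAccepts_cons, ratioMove, hx]
      simp [hmove, ratioAccepts_pop, hx]

lemma ratioAccepts_start (hab : a ≠ b) :
    RatioAccepts a b i (start, [true]) w ↔
      ∃ n, w = List.replicate n a ++ List.replicate ((i + 1) * n) b := by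
  cases w with
  | nil => simp [ratioAccepts_nil]
  | cons x w =>
    rw [exists_cons_eq_replicate_append]
    by_cases hx : x = a
    · have hmove : RatioAccepts a b i (start, [true]) (x :: w) ↔
          RatioAccepts a b i (push, ratioStack 0) w := by
        simp [ratioStack, ratioAccepts_cons, ratioMove, hx]
      rw [hmove]
      simp [ratioAccepts_push hab, hx, mul_comm]
    · simp [ratioAccepts_cons, ratioMove, hx, not_ratioAccepts_dead]

lemma mem_language_ratioPDA (hab : a ≠ b) :
    w ∈ (ratioPDA a b i).language ↔
      ∃ n, w = List.replicate n a ++ List.replicate ((i + 1) * n) b :=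
  (ratioPDA_isRealTime a b i).mem_language_iff.trans (ratioAccepts_start hab)

end Ratio

theorem multiplesLanguage_mem_ExplCFL {α : Type*} {a b : α} (hab : a ≠ b) (k : ℕ) :
    multiplesLanguage a b (k + 1) ∈ ExplCFL (k + 1) α := by
  classical
  let P (i : Fin (k + 1)) := ratioPDA a b i
  refine ⟨_, _, inferInstance, inferInstance, PDA.union P true, ?_, ?_⟩
  · simpa using PDA.union_isExplorable fun i => (ratioPDA_isRealTime a b i).isExplorable_one
  · ext w
    rw [PDA.mem_language_union_iff]
    simp only [P, mem_language_ratioPDA hab]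
    constructor
    · rintro ⟨i, n, rfl⟩
      exact ⟨i + 1, Finset.mem_Icc.2 ⟨Nat.le_add_left 1 i, i.is_lt⟩, n, rfl⟩
    · rintro ⟨i, hi, n, rfl⟩
      obtain ⟨hi_pos, hi_le⟩ := Finset.mem_Icc.1 hi
      obtain ⟨i, rfl⟩ := Nat.exists_eq_add_of_le' hi_pos
      exact ⟨⟨i, hi_le⟩, n, rfl⟩

namespace PDA

variable {Q α Γ : Type*}

/-- Some run of `P` reads `u` up to an accepting configuration and continues from there along `v` to
another accepting one. -/
def AcceptsTwice (P : PDA Q α Γ) (u v : List α) : Prop :=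
  ∃ c d, P.Run P.init u c ∧ c.1 ∈ P.accept ∧ P.Run c v d ∧ d.1 ∈ P.accept

/-- The word `u ++ v` with each letter marked by `false` if it belongs to `u`, and by `true` if it
belongs to `v`. -/
def markedWord (u v : List α) : List (α × Bool) := u.map (·, false) ++ v.map (·, true)

/-- The automaton that recognises the words `markedWord u v` for which `P.AcceptsTwice u v`. It runs
`P` on letters that carry the current phase, and changes once from phase `false` to phase `true`, by
an `ε`-transition in an accepting state. -/
def phasePDA (P : PDA Q α Γ) : PDA (Q × Bool) (α × Bool) Γ where
  δ q x Z := {m |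
    (∃ y : Option α, x = y.map (·, q.2) ∧ (m.1.1, m.2) ∈ P.δ q.1 y Z ∧ m.1.2 = q.2) ∨
      x = none ∧ q.2 = false ∧ q.1 ∈ P.accept ∧ m = ((q.1, true), [Z])}
  push_le_two := by
    rintro q x Z m (⟨y, -, hm, -⟩ | ⟨-, -, -, rfl⟩)
    · exact P.push_le_two _ _ _ _ hm
    · simp
  start := (P.start, false)
  bottom := P.bottom
  accept := {q | q.1 ∈ P.accept ∧ q.2 = true}

/-- The configuration of `phasePDA` in phase `s` that stands for the configuration `c`. -/
def phaseConfig (s : Bool) (c : Q × List Γ) : (Q × Bool) × List Γ := ((c.1, s), c.2)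

lemma length_markedWord {u v : List α} : (markedWord u v).length = u.length + v.length := by
  simp [markedWord]

lemma countP_snd_markedWord {u v : List α} : (markedWord u v).countP (·.2) = v.length := by
  simp [markedWord, List.countP_map, Function.comp_def]

variable {P : PDA Q α Γ}

lemma IsWinningStrategy.run {k : ℕ} {σ : List α → Fin k → Q × List Γ}
    (hσ : P.IsWinningStrategy k σ) (u v : List α) (l : Fin k) :
    P.Run (σ u l) v (σ (u ++ v) l) := by
  induction v using List.reverseRecOn with
  | nil => simpa using .refl _
  | append_singleton v x ih =>
    rw [← List.append_assoc]
    exact ih.trans (hσ.move _ x l).run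

theorem IsExplorable.exists_acceptsTwice {k : ℕ} (hP : P.IsExplorable k)
    {u : Fin (k + 1) → List α} (hu : ∀ i, u i ∈ P.language)
    (hprefix : ∀ i j, i < j → u i <+: u j) :
    ∃ i j v, i < j ∧ u i ++ v = u j ∧ P.AcceptsTwice (u i) v := by
  obtain ⟨σ, hσ⟩ := hP
  choose l hl using fun i => hσ.wins _ (hu i)
  obtain ⟨i, j, hij, hlij⟩ : ∃ i j, i < j ∧ l i = l j := by
    obtain ⟨i, j, hne, h⟩ := Fintype.exists_ne_map_eq_of_card_lt l (by simp)
    rcases lt_or_gt_of_ne hne with hlt | hlt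
    · exact ⟨i, j, hlt, h⟩
    · exact ⟨j, i, hlt, h.symm⟩
  obtain ⟨v, hv⟩ := hprefix i j hij
  refine ⟨i, j, v, hij, hv, σ (u i) (l i), σ (u j) (l i), ?_, hl i, ?_, hlij ▸ hl j⟩
  · simpa [hσ.init] using hσ.run [] (u i) (l i)
  · simpa [hv] using hσ.run (u i) v (l i)

lemma Step.phaseConfig {x : Option α} {c d : Q × List Γ} (s : Bool) (h : P.Step x c d) :
    P.phasePDA.Step (x.map (·, s)) (phaseConfig s c) (phaseConfig s d) := by
  cases h with
  | mk q p x Z β γ hm => exact .mk _ _ _ _ _ _ (.inl ⟨x, rfl, hm, rfl⟩)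

lemma step_phaseConfig {x : Option (α × Bool)} {s : Bool} {c : Q × List Γ}
    {d' : (Q × Bool) × List Γ} (h : P.phasePDA.Step x (phaseConfig s c) d') :
    (∃ y d, P.Step y c d ∧ x = y.map (·, s) ∧ d' = phaseConfig s d) ∨
      x = none ∧ s = false ∧ c.1 ∈ P.accept ∧ d' = phaseConfig true c := by
  obtain ⟨q, γ⟩ := c
  cases h with
  | mk _ p _ Z β γ hm =>
    obtain ⟨p, s'⟩ := p
    rcases hm with ⟨y, rfl, hm, rfl⟩ | ⟨rfl, rfl, hq, hp⟩
    · exact .inl ⟨y, (p, β ++ γ), .mk _ _ _ _ _ _ hm, rfl, rfl⟩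
    · cases hp
      exact .inr ⟨rfl, rfl, hq, rfl⟩

lemma Run.stack_ne_nil {c d : Q × List Γ} {w : List α} (r : P.Run c w d) (hw : w ≠ []) :
    c.2 ≠ [] := by
  cases r with
  | refl => exact absurd rfl hw
  | eps h | read h => cases h; simp

lemma AcceptsTwice.markedWord_mem {u v : List α} (h : P.AcceptsTwice u v) (hv : v ≠ []) :
    markedWord u v ∈ P.phasePDA.language := by
  obtain ⟨⟨q, γ⟩, d, r, hc, s, hd⟩ := h
  have hswitch : P.phasePDA.Step none (phaseConfig false (q, γ)) (phaseConfig true (q, γ)) := by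
    obtain ⟨Z, γ, rfl⟩ := List.exists_cons_of_ne_nil (s.stack_ne_nil hv)
    exact .mk _ _ _ _ [Z] γ (.inr ⟨rfl, rfl, hc, rfl⟩)
  exact ⟨phaseConfig true d, (r.map fun _ _ _ => Step.phaseConfig false).trans
    (.eps hswitch (s.map fun _ _ _ => Step.phaseConfig true)), hd, rfl⟩

lemma Run.exists_of_phaseConfig_true {c : Q × List Γ} {d' : (Q × Bool) × List Γ}
    {w : List (α × Bool)} (r : P.phasePDA.Run (phaseConfig true c) w d') :
    ∃ v d, P.Run c v d ∧ w = v.map (·, true) ∧ d' = phaseConfig true d :=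
  r.exists_of_map fun _ _ _ h => (step_phaseConfig h).resolve_right (by simp)

lemma Run.exists_of_phaseConfig_false {c : Q × List Γ} {d' : (Q × Bool) × List Γ}
    {w : List (α × Bool)} (r : P.phasePDA.Run (phaseConfig false c) w d')
    (hd : d'.1 ∈ P.phasePDA.accept) :
    ∃ u v e d, w = markedWord u v ∧ P.Run c u e ∧ e.1 ∈ P.accept ∧ P.Run e v d ∧
      d.1 ∈ P.accept := by
  generalize hc : phaseConfig false c = c' at r
  induction r using Run.step_induction generalizing c with
  | refl => exact absurd (hc ▸ hd.2) (by simp [phaseConfig])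
  | step x c₁ c₂ w' h r ih =>
    subst hc
    rcases step_phaseConfig h with ⟨y, e, hy, rfl, rfl⟩ | ⟨rfl, -, he, rfl⟩
    · obtain ⟨u, v, e, d, rfl, ru, he, rv, hd⟩ := ih rfl
      exact ⟨y.toList ++ u, v, e, d, by simp [markedWord, Option.toList_map], hy.run ru, he, rv, hd⟩
    · obtain ⟨v, d, rv, rfl, rfl⟩ := r.exists_of_phaseConfig_true
      exact ⟨[], v, c, d, rfl, .refl _, he, rv, hd.1⟩

lemma exists_acceptsTwice_of_mem_language_phasePDA {w : List (α × Bool)}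
    (hw : w ∈ P.phasePDA.language) : ∃ u v, w = markedWord u v ∧ P.AcceptsTwice u v := by
  obtain ⟨d', r, hd⟩ := hw
  obtain ⟨u, v, e, d, rfl, h⟩ := Run.exists_of_phaseConfig_false (c := P.init) r hd
  exact ⟨u, v, rfl, e, d, h⟩

lemma AcceptsTwice.mem_language {u v : List α} (h : P.AcceptsTwice u v) :
    u ∈ P.language ∧ u ++ v ∈ P.language := by
  obtain ⟨c, d, r, hc, s, hd⟩ := h
  exact ⟨⟨c, r, hc⟩, d, r.trans s, hd⟩

end PDA

section Divisibility

open PDA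

variable {α : Type*} [DecidableEq α] {a b : α} {k : ℕ} {u v w : List α}

lemma count_false_markedWord : (markedWord u v).count (a, false) = u.count a := by
  rw [markedWord, List.count_append, List.count_map_of_injective _ _ (Prod.mk_left_injective _),
    List.count_eq_zero.2 (by simp : (a, false) ∉ v.map (·, true)), add_zero]

lemma count_dvd_length_of_mem_multiplesLanguage (hab : a ≠ b) (hw : w ∈ multiplesLanguage a b k) :
    w.count a ∣ w.length := by
  obtain ⟨i, -, n, rfl⟩ := hw
  simp [List.count_replicate, hab.symm]

lemma count_eq_zero_of_append_mem_multiplesLanguage (hab : a ≠ b)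
    (hu : u ∈ multiplesLanguage a b k) (ha : a ∈ u) (huv : u ++ v ∈ multiplesLanguage a b k) :
    v.count a = 0 := by
  have hb : b ∈ u := by
    obtain ⟨i, hi, n, rfl⟩ := hu
    have hn : n ≠ 0 := by rintro rfl; simp at ha
    have hi' := (Finset.mem_Icc.1 hi).1
    simp [hn, Nat.one_le_iff_ne_zero.1 hi']
  obtain ⟨j, -, m, h⟩ := huv
  rw [List.count_eq_zero]
  rcases List.append_eq_append_iff.1 h with ⟨c, hm, -⟩ | ⟨c, -, hv⟩
  · exact absurd (List.eq_of_mem_replicate (hm ▸ List.mem_append_left c hb)) hab.symm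
  · exact fun hav => hab (List.eq_of_mem_replicate (hv ▸ List.mem_append_right c hav))

variable {Q Γ : Type*} {P : PDA Q α Γ}

lemma count_false_dvd_of_mem_language_phasePDA (hab : a ≠ b)
    (hP : P.language = multiplesLanguage a b k) {w : List (α × Bool)}
    (hw : w ∈ P.phasePDA.language) (ha : (a, false) ∈ w) :
    w.count (a, false) ∣ w.length ∧ w.count (a, false) ∣ w.countP (·.2) := by
  obtain ⟨u, v, rfl, h⟩ := exists_acceptsTwice_of_mem_language_phasePDA hw
  obtain ⟨hu, huv⟩ := hP ▸ h.mem_language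
  have hau : a ∈ u := by simpa [markedWord] using ha
  have hdvd_u := count_dvd_length_of_mem_multiplesLanguage hab hu
  have hdvd_uv := count_dvd_length_of_mem_multiplesLanguage hab huv
  rw [List.count_append, count_eq_zero_of_append_mem_multiplesLanguage hab hu hau huv, add_zero,
    List.length_append] at hdvd_uv
  rw [count_false_markedWord, length_markedWord, countP_snd_markedWord]
  exact ⟨hdvd_uv, (Nat.dvd_add_right hdvd_u).1 hdvd_uv⟩

lemma countP_pumped {β : Type*} (f : β → Bool) (u v x y z : List β) (t : ℕ) :
    (u ++ (List.replicate t v).flatten ++ x ++ (List.replicate t y).flatten ++ z).countP f =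
      (u ++ x ++ z).countP f + t * (v ++ y).countP f := by
  simp only [List.countP_append, List.countP_flatten, List.map_replicate, List.sum_replicate,
    smul_eq_mul]
  ring

variable {u v x y z : List (α × Bool)}

lemma count_false_le_length_of_mem (hab : a ≠ b)
    (hP : P.language = multiplesLanguage a b k)
    (h₀ : u ++ x ++ z ∈ P.phasePDA.language) (h₁ : u ++ v ++ x ++ y ++ z ∈ P.phasePDA.language)
    (ha : (a, false) ∈ u ++ x ++ z) (hvy : (a, false) ∉ v ++ y) (hpos : 0 < (v ++ y).length) :
    (u ++ x ++ z).count (a, false) ≤ (v ++ y).length := by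
  have hcount : (u ++ v ++ x ++ y ++ z).count (a, false) = (u ++ x ++ z).count (a, false) := by
    have := countP_pumped (· == (a, false)) u v x y z 1
    rw [← List.count_eq_countP, ← List.count_eq_countP, ← List.count_eq_countP,
      List.count_eq_zero.2 hvy, mul_zero, add_zero] at this
    simpa using this
  have hlength : (u ++ v ++ x ++ y ++ z).length = (u ++ x ++ z).length + (v ++ y).length := by
    simp only [List.length_append]
    ring
  have hdvd₀ := count_false_dvd_of_mem_language_phasePDA hab hP h₀ ha
  have hdvd₁ := count_false_dvd_of_mem_language_phasePDA hab hP h₁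
    (List.count_pos_iff.1 (hcount ▸ List.count_pos_iff.2 ha))
  rw [hcount, hlength] at hdvd₁
  exact Nat.le_of_dvd hpos ((Nat.dvd_add_right hdvd₀.1).1 hdvd₁.1)

end Divisibility

section LowerBound

open PDA

variable {α : Type*} {a b : α}

lemma notMem_of_pumped_mem {Q Γ : Type*} {P : PDA Q α Γ} {k : ℕ} {u v x y z : List (α × Bool)}
    (hab : a ≠ b) (hP : P.language = multiplesLanguage a b k)
    (hpump : ∀ t, u ++ (List.replicate t v).flatten ++ x ++ (List.replicate t y).flatten ++ z ∈
      P.phasePDA.language)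
    (hpos : 0 < (u ++ x ++ z).countP (·.2)) (hvy : (v ++ y).countP (·.2) = 0) :
    (a, false) ∉ v ++ y := by
  classical
  intro ha
  set m := (u ++ x ++ z).countP (·.2)
  have hlarge : m + 1 ≤ (u ++ (List.replicate (m + 1) v).flatten ++ x ++
      (List.replicate (m + 1) y).flatten ++ z).count (a, false) := by
    rw [List.count_eq_countP, countP_pumped, ← List.count_eq_countP, ← List.count_eq_countP]
    exact le_add_left (Nat.le_mul_of_pos_right _ (List.count_pos_iff.2 ha))
  have hdvd := (count_false_dvd_of_mem_language_phasePDA hab hP (hpump (m + 1))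
    (List.count_pos_iff.1 (m.succ_pos.trans_le hlarge))).2
  rw [countP_pumped _ u, hvy, mul_zero, add_zero] at hdvd
  exact (hlarge.trans (Nat.le_of_dvd hpos hdvd)).not_gt m.lt_succ_self

lemma length_lt_of_mem_of_replicate_append_eq {β : Type*} {s : β} {n : ℕ} {r u v z : List β}
    (h : List.replicate n s ++ r = u ++ v ++ z) (hr : s ∉ r) (hv : s ∈ v) : u.length < n := by
  by_contra! hn
  have hdrop := congrArg (List.drop n) h
  rw [List.drop_left' List.length_replicate, List.append_assoc,
    List.drop_append_of_le_length hn] at hdrop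
  exact hr (by simp [hdrop, hv])

lemma countP_snd_eq_zero_of_markedWord_eq {u v : List α} {r s t : List (α × Bool)}
    (h : markedWord u v = r ++ s ++ t) (hlen : (r ++ s).length ≤ u.length) :
    s.countP (·.2) = 0 := by
  have hprefix : r ++ s <+: u.map (·, false) :=
    List.prefix_of_prefix_length_le ⟨t, h.symm⟩ (List.prefix_append _ _) (by simpa using hlen)
  rw [List.countP_eq_zero]
  intro c hc
  obtain ⟨d, -, rfl⟩ := List.mem_map.1 (hprefix.subset (List.mem_append_right r hc))
  exact Bool.false_ne_true

lemma countP_snd_eq_zero_of_mem_window (hab : a ≠ b) {n m : ℕ} {w : List α}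
    {r s t : List (α × Bool)}
    (h : markedWord (List.replicate n a ++ List.replicate m b) w = r ++ s ++ t)
    (ha : (a, false) ∈ s) (hlen : s.length ≤ m) : s.countP (·.2) = 0 := by
  have hr : r.length < n := by
    have hnotMem : (a, false) ∉ (List.replicate m b).map (·, false) ++ w.map (·, true) := by
      simp [hab]
    refine length_lt_of_mem_of_replicate_append_eq (Eq.trans ?_ h) hnotMem ha
    simp [markedWord]
  refine countP_snd_eq_zero_of_markedWord_eq h ?_
  simp only [List.length_append, List.length_replicate]
  lia

theorem exists_not_acceptsTwice [Finite α] {Q Γ : Type} [Finite Q] [Finite Γ] {P : PDA Q α Γ}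
    (hab : a ≠ b) {k : ℕ} (hP : P.language = multiplesLanguage a b k) :
    ∃ n, ∀ i e, 0 < i → 0 < e →
      ¬ P.AcceptsTwice (List.replicate n a ++ List.replicate (i * n) b)
        (List.replicate (e * n) b) := by
  classical
  obtain ⟨p, hp⟩ := exists_pumping_of_isContextFree
    ⟨P.phasePDA.tripleGrammar, P.phasePDA.language_tripleGrammar⟩
  refine ⟨p + 1, fun i e hi he htwice => ?_⟩
  set n := p + 1
  set first := List.replicate n a ++ List.replicate (i * n) b with hfirst
  set second := List.replicate (e * n) b with hsecond
  have hsecond_pos : 0 < second.length := by simp [hsecond, n, he]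
  have hin : n ≤ i * n := Nat.le_mul_of_pos_left n hi
  obtain ⟨u, v, x, y, z, hW, hpos, hlen, hpump⟩ :=
    hp _ (htwice.markedWord_mem (List.ne_nil_of_length_pos hsecond_pos))
      (by rw [length_markedWord, List.length_append, List.length_replicate]; lia)
  have hcount (f : α × Bool → Bool) :
      (markedWord first second).countP f = (u ++ x ++ z).countP f + (v ++ y).countP f := by
    simpa [hW] using countP_pumped f u v x y z 1
  have hn : (u ++ x ++ z).count (a, false) + (v ++ y).count (a, false) = n := by
    rw [List.count_eq_countP, List.count_eq_countP, ← hcount, ← List.count_eq_countP,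
      count_false_markedWord]
    simp [hfirst, List.count_replicate, hab.symm]
  have hvxy : (v ++ y).Sublist (v ++ x ++ y) := by simp
  have hvy : (a, false) ∉ v ++ y := by
    intro ha
    have hmarked : (v ++ y).countP (·.2) = 0 := Nat.eq_zero_of_le_zero <|
      hvxy.countP_le.trans_eq <|
        countP_snd_eq_zero_of_mem_window hab (by simpa using hW) (hvxy.subset ha) (by lia)
    have hsecond_eq := hcount (·.2)
    rw [countP_snd_markedWord, hmarked, add_zero] at hsecond_eq
    exact notMem_of_pumped_mem hab hP hpump (hsecond_eq ▸ hsecond_pos) hmarked ha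
  rw [List.count_eq_zero.2 hvy, add_zero] at hn
  have ha : (a, false) ∈ u ++ x ++ z := List.count_pos_iff.1 (hn ▸ p.succ_pos)
  have hle := count_false_le_length_of_mem hab hP (by simpa using hpump 0)
    (by simpa using hpump 1) ha hvy hpos
  have := hvxy.length_le
  lia

theorem multiplesLanguage_notMem_ExplCFL [Finite α] (hab : a ≠ b) (k : ℕ) :
    multiplesLanguage a b (k + 1) ∉ ExplCFL k α := by
  rintro ⟨Q, Γ, _, _, P, hexpl, hP⟩
  obtain ⟨n, htwice⟩ := exists_not_acceptsTwice hab hP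
  let u (i : Fin (k + 1)) := List.replicate n a ++ List.replicate ((i + 1) * n) b
  have hu_append {i j : Fin (k + 1)} (hij : i < j) :
      u i ++ List.replicate ((j - i) * n) b = u j := by
    simp only [u, List.append_assoc, List.replicate_append_replicate, ← add_mul]
    rw [add_right_comm, Nat.add_sub_cancel' (Fin.le_def.1 hij.le)]
  obtain ⟨i, j, v, hij, hv, h⟩ := hexpl.exists_acceptsTwice (u := u)
    (fun i => hP ▸ ⟨i + 1, Finset.mem_Icc.2 ⟨Nat.le_add_left 1 i, i.is_lt⟩, n, rfl⟩)
    (fun i j hij => ⟨_, hu_append hij⟩)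
  obtain rfl := List.append_cancel_left (hv.trans (hu_append hij).symm)
  exact htwice _ _ (Nat.succ_pos i) (Nat.sub_pos_of_lt hij) h

end LowerBound

end Explorability

theorem mainTheorem1 {α : Type*} [Finite α] (k : ℕ) :
    (Explorability.ExplCFL k α ⊆ Explorability.ExplCFL (k + 1) α ∧
      Explorability.ExplCFL (k + 1) α ⊆ Explorability.CFL α) ∧
    ∀ a b : α, a ≠ b →
      (Explorability.ExplCFL k α ⊂ Explorability.ExplCFL (k + 1) α ∧
        Explorability.ExplCFL (k + 1) α ⊂ Explorability.CFL α) ∧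
      Explorability.multiplesLanguage a b (k + 1) ∈ Explorability.ExplCFL (k + 1) α ∧
      Explorability.multiplesLanguage a b (k + 1) ∉ Explorability.ExplCFL k α := by
  open Explorability in
  have subset_CFL (m : ℕ) : ExplCFL m α ⊆ CFL α := fun _ => isContextFree_of_mem_ExplCFL
  refine ⟨⟨ExplCFL_subset_succ k α, subset_CFL (k + 1)⟩, fun a b hab => ?_⟩
  have mem (m : ℕ) := multiplesLanguage_mem_ExplCFL hab m
  have notMem (m : ℕ) := multiplesLanguage_notMem_ExplCFL hab m
  exact ⟨⟨⟨ExplCFL_subset_succ k α, fun h => notMem k (h (mem k))⟩,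
    subset_CFL (k + 1), fun h => notMem (k + 1) (h (subset_CFL _ (mem (k + 1))))⟩, mem k, notMem k⟩
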